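/- Let $k$ be a field of characteristic $0$ and $n\ge 1$. Let $A=k[x_{ij}]_{1\le i,j\le n}/(\det(x_{ij})-1)$ be the ring of functions of the group scheme $SL_n$ over $k$, let $A^*=\operatorname{Hom}_k(A,k)$ with the algebra structure dual to the comultiplication $x_{ij}\mapsto\sum_l x_{il}\otimes x_{lj}$ of $A$, and regard $A^*$ as a subspace of $k[x_{ij}]^*$ by means of the projection $k[x_{ij}]\to A$. The invariant integral on $SL_n$ is the linear form $w_{SL_n}\in A^*$ with $w_{SL_n}(1)=1$ and $\phi\cdot w_{SL_n}=\phi(1)\,w_{SL_n}=w_{SL_n}\cdot\phi$ for all $\phi\in A^*$. Let $D=\det(\partial/\partial x_{ij})$ be the Cayley operator on $k[x_{ij}]$ and let $D_0^i\in k[x_{ij}]^*$ be the linear form $p\mapsto (D^i p)(0)$, for $i\ge 0$. Then $SL_n$ has a unique invariant integral, $D_0^i(\det^i)\ne 0$ for all $i\ge 0$, and $$w_{SL_n}=\sum_{i\ge 0}\frac{D_0^i}{D_0^i(\det^i)},$$ that is, for every $p\in k[x_{ij}]$ only finitely many of the numbers $D_0^i(p)$ are non-zero, and the value of $w_{SL_n}$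 on the class of $p$ is $\sum_{i\ge 0} D_0^i(p)/D_0^i(\det^i)$. Moreover, let $E$ be a $k$-vector space of dimension $n$, and let the group scheme $SL(E)$ act on $E^{\otimes nm}$ by $g\cdot(v_1\otimes\cdots\otimes v_{nm})=gv_1\otimes\cdots\otimes gv_{nm}$. Then for every $m\ge 0$ $$\dim_k\,(E^{\otimes nm})^{SL(E)}=\frac{(nm)!}{D_0^m(\det^m)},$$ where $D_0^m(\det^m)$ is the value of the constant $D^m(\det^m)$. -/

import Mathlib

open scoped TensorProduct

universe u v

noncomputable section

namespace CayleyIntegral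

/-- The ring of functions `k[x_{ij}]` of the semigroup `M_n` of `n × n` matrices. -/
abbrev MatCoord (k : Type u) [Field k] (n : ℕ) : Type u :=
  MvPolynomial (Fin n × Fin n) k

/-- The polynomial `det (x_{ij})`. -/
def detX (k : Type u) [Field k] (n : ℕ) : MatCoord k n :=
  (Matrix.mvPolynomialX (Fin n) (Fin n) k).det

/-- The ideal `(det (x_{ij}) - 1)` of `k[x_{ij}]`. -/
def slIdeal (k : Type u) [Field k] (n : ℕ) : Ideal (MatCoord k n) :=
  Ideal.span {detX k n - 1}

/-- The ring of functions `k[x_{ij}] / (det (x_{ij}) - 1)` of the special linear group. -/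
def SLCoord (k : Type u) [Field k] (n : ℕ) : Type u :=
  MatCoord k n ⧸ slIdeal k n

instance (k : Type u) [Field k] (n : ℕ) : CommRing (SLCoord k n) :=
  inferInstanceAs (CommRing (MatCoord k n ⧸ slIdeal k n))

instance (k : Type u) [Field k] (n : ℕ) : Algebra k (SLCoord k n) :=
  inferInstanceAs (Algebra k (MatCoord k n ⧸ slIdeal k n))

/-- The restriction of functions `k[x_{ij}] → k[x_{ij}] / (det (x_{ij}) - 1)`. -/
def slRestrict (k : Type u) [Field k] (n : ℕ) : MatCoord k n →ₐ[k] SLCoord k n :=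
  Ideal.Quotient.mkₐ k (slIdeal k n)

/-- The generic matrix of the special linear group. -/
def slGeneric (k : Type u) [Field k] (n : ℕ) : Matrix (Fin n) (Fin n) (SLCoord k n) :=
  Matrix.of fun i j => slRestrict k n (MvPolynomial.X (i, j))

theorem slGeneric_eq_map (k : Type u) [Field k] (n : ℕ) :
    slGeneric k n = (slRestrict k n).mapMatrix (Matrix.mvPolynomialX (Fin n) (Fin n) k) := by
  ext i j
  simp [slGeneric]

theorem det_slGeneric (k : Type u) [Field k] (n : ℕ) : (slGeneric k n).det = 1 := by
  have h : slRestrict k n (detX k n - 1) = 0 :=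
    Ideal.Quotient.eq_zero_iff_mem.mpr (Ideal.subset_span rfl)
  rw [map_sub, map_one, sub_eq_zero] at h
  rw [slGeneric_eq_map, ← AlgHom.map_det]
  exact h

/-- The matrix of the product of the two universal points, with entries
`∑ l, x_{il} ⊗ x_{lj}`. -/
def slProduct (k : Type u) [Field k] (n : ℕ) :
    Matrix (Fin n) (Fin n) (SLCoord k n ⊗[k] SLCoord k n) :=
  Matrix.of fun i j => ∑ l, slGeneric k n i l ⊗ₜ[k] slGeneric k n l j

theorem slProduct_eq_mul (k : Type u) [Field k] (n : ℕ) :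
    slProduct k n =
      (Algebra.TensorProduct.includeLeft :
        SLCoord k n →ₐ[k] SLCoord k n ⊗[k] SLCoord k n).mapMatrix (slGeneric k n) *
      (Algebra.TensorProduct.includeRight :
        SLCoord k n →ₐ[k] SLCoord k n ⊗[k] SLCoord k n).mapMatrix (slGeneric k n) := by
  ext i j
  simp [slProduct, Matrix.mul_apply]

theorem det_slProduct (k : Type u) [Field k] (n : ℕ) : (slProduct k n).det = 1 := by
  rw [slProduct_eq_mul, Matrix.det_mul, ← AlgHom.map_det, ← AlgHom.map_det, det_slGeneric,
    map_one, map_one, one_mul]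

theorem aeval_slProduct_detX (k : Type u) [Field k] (n : ℕ) :
    MvPolynomial.aeval (fun ij : Fin n × Fin n => slProduct k n ij.1 ij.2) (detX k n) = 1 := by
  rw [detX, AlgHom.map_det]
  refine Eq.trans (congrArg Matrix.det ?_) (det_slProduct k n)
  ext i j
  simp

/-- The comultiplication of the ring of functions of the special linear group, which is the
morphism of rings of functions induced by the multiplication of the group:
`x_{ij} ↦ ∑ l, x_{il} ⊗ x_{lj}`. -/
def slComul (k : Type u) [Field k] (n : ℕ) :
    SLCoord k n →ₐ[k] SLCoord k n ⊗[k] SLCoord k n :=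
  Ideal.Quotient.liftₐ (slIdeal k n)
    (MvPolynomial.aeval fun ij : Fin n × Fin n => slProduct k n ij.1 ij.2) (by
      intro a ha
      have h : slIdeal k n ≤ RingHom.ker
          (MvPolynomial.aeval fun ij : Fin n × Fin n => slProduct k n ij.1 ij.2) := by
        refine Ideal.span_le.mpr ?_
        rintro _ rfl
        rw [SetLike.mem_coe, RingHom.mem_ker, map_sub, aeval_slProduct_detX, map_one, sub_self]
      exact h ha)

/-- The product of the algebra `A^*` dual to the ring of functions `A` of the special linear
group: `(φ · ψ)(a) = (φ ⊗ ψ)(Δ a)`. On points it is the product of the group. -/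
def dualMul {k : Type u} [Field k] {n : ℕ} (φ ψ : Module.Dual k (SLCoord k n)) :
    Module.Dual k (SLCoord k n) :=
  LinearMap.mul' k k ∘ₗ TensorProduct.map φ ψ ∘ₗ (slComul k n).toLinearMap

/-- `w ∈ A^*` is the invariant integral on the special linear group: it is normalized,
`w 1 = 1`, and invariant under multiplication on both sides, where `A^*` acts on the trivial
representation through `φ ↦ φ 1`. Equivalently, `w = (1, 0)` in a decomposition of algebras
`A^* = k × B^*` whose first projection is `φ ↦ φ 1`. -/
structure IsInvariantIntegral {k : Type u} [Field k] {n : ℕ}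
    (w : Module.Dual k (SLCoord k n)) : Prop where
  normalized : w 1 = 1
  left_invariant : ∀ φ : Module.Dual k (SLCoord k n), dualMul φ w = φ 1 • w
  right_invariant : ∀ φ : Module.Dual k (SLCoord k n), dualMul w φ = φ 1 • w

/-- The inclusion of `A_{SL_n}^*` in `k[x_{ij}]^*`, dual to the restriction of functions. -/
def dualInclusion (k : Type u) [Field k] (n : ℕ) :
    Module.Dual k (SLCoord k n) →ₗ[k] Module.Dual k (MatCoord k n) :=
  (slRestrict k n).toLinearMap.dualMap

/-- The Cayley operator `D = det (∂/∂x_{ij})` on `k[x_{ij}]`, as the Leibniz expansion of the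
determinant; products are compositions of the (commuting) operators. -/
def cayleyOp (k : Type u) [Field k] (n : ℕ) : Module.End k (MatCoord k n) :=
  ∑ σ : Equiv.Perm (Fin n), ((Equiv.Perm.sign σ : ℤˣ) : ℤ) •
    (List.ofFn fun i : Fin n =>
      ((MvPolynomial.pderiv (R := k) (σ i, i)).toLinearMap : Module.End k (MatCoord k n))).prod

/-- The linear form `D_0^i : p ↦ (D^i p)(0)`. -/
def cayleyAtZero (k : Type u) [Field k] (n i : ℕ) : Module.Dual k (MatCoord k n) :=
  (MvPolynomial.aeval (fun _ : Fin n × Fin n => (0 : k))).toLinearMap ∘ₗ (cayleyOp k n ^ i)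

/-- The natural map from the tensor power `E^{⊗N}` over `k` to the tensor power
`(B ⊗ E)^{⊗N}` over `B`, `v_1 ⊗ ⋯ ⊗ v_N ↦ (1 ⊗ v_1) ⊗ ⋯ ⊗ (1 ⊗ v_N)`. -/
def tensorPowerBaseChange (k : Type u) [Field k] (E : Type v) [AddCommGroup E] [Module k E]
    (N : ℕ) (B : Type u) [CommRing B] [Algebra k B] :
    (⨂[k] _ : Fin N, E) →ₗ[k] (⨂[B] _ : Fin N, (B ⊗[k] E)) :=
  PiTensorProduct.lift
    (((PiTensorProduct.tprod B (s := fun _ : Fin N => B ⊗[k] E)).restrictScalars k).compLinearMap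
      fun _ => TensorProduct.mk k B E 1)

/-- The invariants of the group scheme `SL(E)` in `E^{⊗N}`, for the natural action
`g · (v_1 ⊗ ⋯ ⊗ v_N) = g v_1 ⊗ ⋯ ⊗ g v_N`: the tensors fixed by every point `g` of `SL(E)` with
values in a commutative `k`-algebra `B`, that is, by every endomorphism of the `B`-module
`B ⊗ E` of determinant one. -/
def tensorPowerInvariants (k : Type u) [Field k] (E : Type v) [AddCommGroup E] [Module k E]
    (N : ℕ) : Submodule k (⨂[k] _ : Fin N, E) where
  carrier := {t | ∀ (B : Type u) [CommRing B] [Algebra k B] (g : (B ⊗[k] E) →ₗ[B] (B ⊗[k] E)),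
    LinearMap.det g = 1 →
      PiTensorProduct.map (fun _ => g) (tensorPowerBaseChange k E N B t) =
        tensorPowerBaseChange k E N B t}
  zero_mem' := by
    intro B _ _ g _
    simp
  add_mem' := by
    intro s t hs ht B _ _ g hg
    rw [map_add, map_add, hs B g hg, ht B g hg]
  smul_mem' := by
    intro c t ht B _ _ g hg
    rw [map_smul, ← algebraMap_smul B c (tensorPowerBaseChange k E N B t), map_smul, ht B g hg]

end CayleyIntegral

end

/-! The pairing `(p, q) ↦ (p(∂) q)(0)` is symmetric, monomials are orthogonal for it with weights
`α!`, and the substitutions by `S` and `Sᵀ` are adjoint. Since `D = det(∂)`, `D_0^i` is pairing with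
`det^i`. As `det(gx) = det(g) det(x) = det(xg)`, replacing `x` by `gx` or `xg` multiplies `D_0^i` by
`det(g)^i` (`cayleyAtZero_linSubst`). So the integral of `x ↦ p(gx)` is a polynomial in `det(g)`,
constant on `SL_n`: this is invariance.

The series descends to `A` because `p` and `det · p` have the same value: Cayley's identity `D
det^(i+1) = a det^i` and adjunction show that the normalized terms of `det · p` are those of `p`
shifted by one (`cayleyAtZero_succ_detX_mul`).

For the dimension, the integral acts on `E^{⊗N}` as a projector onto the invariants
(`isProj_tensorAction`). Its trace is the integral of `tr^N`, and pairing `det^m` with the power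
`tr^(nm)` of a linear form gives `(nm)! det(1)^m`. -/

noncomputable section

/-! ### Constant-coefficient operators and the pairing `(p(∂) q)(0)` -/

namespace MvPolynomial

variable {σ R : Type*} [CommRing R]

theorem pderiv_comm (i j : σ) (p : MvPolynomial σ R) :
    pderiv i (pderiv j p) = pderiv j (pderiv i p) := by
  classical
  ext m
  rw [coeff_pderiv, coeff_pderiv, coeff_pderiv, coeff_pderiv,
    add_right_comm m (Finsupp.single j 1)]
  rcases eq_or_ne i j with rfl | h
  · rfl
  · simp [h, h.symm]
    ring

variable (σ R) in
/-- The algebra of differential operators with constant coefficients. -/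
abbrev constDiffOps : Subalgebra R (Module.End R (MvPolynomial σ R)) :=
  Algebra.adjoin R (Set.range fun i : σ => (pderiv i).toLinearMap)

instance : IsMulCommutative (constDiffOps σ R) :=
  Algebra.isMulCommutative_adjoin R (by
    rintro _ ⟨i, rfl⟩ _ ⟨j, rfl⟩
    exact LinearMap.ext fun p => pderiv_comm i j p)

variable (σ R) in
/-- The algebra morphism sending a polynomial to the corresponding differential operator with
constant coefficients, `X i ↦ ∂/∂X i`. -/
def diffOp : MvPolynomial σ R →ₐ[R] Module.End R (MvPolynomial σ R) :=
  -- `aeval` needs a commutative target, so it takes values in the subalgebra generated by the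
  -- partial derivatives.
  letI : CommSemiring (constDiffOps σ R) :=
    { (constDiffOps σ R).toSemiring with mul_comm := fun a b => mul_comm' a b }
  (constDiffOps σ R).val.comp
    (aeval (S₁ := constDiffOps σ R) fun i =>
      ⟨(pderiv i).toLinearMap, Algebra.subset_adjoin (Set.mem_range_self i)⟩)

@[simp]
theorem diffOp_X (i : σ) : diffOp σ R (X i) = (pderiv i).toLinearMap := by
  simp [diffOp]

/-- This is `∂^α x^(α+β) = ((α+β)!/β!) x^β`, cleared of denominators so as to hold over any
commutative ring. -/
theorem factorial_mul_coeff_diffOp_monomial [Fintype σ] (α β : σ →₀ ℕ) (q : MvPolynomial σ R) :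
    (∏ i, ((β i).factorial : R)) * coeff β (diffOp σ R (monomial α 1) q) =
      (∏ i, (((α + β) i).factorial : R)) * coeff (α + β) q := by
  classical
  induction α using Finsupp.induction_linear generalizing q β with
  | zero => rw [monomial_zero', map_one, map_one, Module.End.one_apply, zero_add]
  | add f g hf hg =>
    rw [← one_mul (1 : R), ← monomial_mul, map_mul, Module.End.mul_apply, hf, hg,
      ← add_assoc, add_comm g f]
  | single i b =>
    induction b generalizing q β with
    | zero =>
      rw [Finsupp.single_zero, monomial_zero', map_one, map_one, Module.End.one_apply, zero_add]
    | succ b hb =>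
      rw [Finsupp.single_add, ← one_mul (1 : R), ← monomial_mul, map_mul, Module.End.mul_apply, hb,
        ← X, diffOp_X]
      have h : Finsupp.single i b + Finsupp.single i 1 + β =
        Finsupp.single i b + β + Finsupp.single i 1 := by abel
      rw [h, Derivation.coeFn_coe, coeff_pderiv]
      generalize Finsupp.single i b + β = γ
      rw [← Finset.mul_prod_erase _ (fun j => ((γ j).factorial : R)) (Finset.mem_univ i),
        ← Finset.mul_prod_erase _ (fun j => (((γ + Finsupp.single i 1 : σ →₀ ℕ) j).factorial : R))
          (Finset.mem_univ i),
        Finset.prod_congr rfl fun j hj =>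
          show (((γ + Finsupp.single i 1 : σ →₀ ℕ) j).factorial : R) = ((γ j).factorial : R) by
            simp [(Finset.ne_of_mem_erase hj).symm]]
      simp [Nat.factorial_succ]
      ring

/-- The formula in coefficients for the pairing `(p, q) ↦ (p(∂) q)(0)`. -/
theorem constantCoeff_diffOp [Fintype σ] (p q : MvPolynomial σ R) :
    constantCoeff (diffOp σ R p q) =
      ∑ α ∈ p.support, (∏ i, ((α i).factorial : R)) * (coeff α p * coeff α q) := by
  conv_lhs => rw [← support_sum_monomial_coeff p]
  rw [map_sum, LinearMap.sum_apply, map_sum]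
  refine Finset.sum_congr rfl fun α _ => ?_
  have h := factorial_mul_coeff_diffOp_monomial α 0 q
  simp only [Finsupp.coe_zero, Pi.zero_apply, Nat.factorial_zero, Nat.cast_one, Finset.prod_const_one,
    one_mul, add_zero] at h
  rw [← mul_one (coeff α p), ← smul_eq_mul, ← smul_monomial, map_smul, LinearMap.smul_apply,
    ← constantCoeff_eq] at *
  simp [h]
  ring

theorem constantCoeff_diffOp_comm [Fintype σ] (p q : MvPolynomial σ R) :
    constantCoeff (diffOp σ R p q) = constantCoeff (diffOp σ R q p) := by
  classical
  rw [constantCoeff_diffOp, constantCoeff_diffOp,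
    Finset.sum_subset (Finset.subset_union_left (s₂ := q.support)),
    Finset.sum_subset (Finset.subset_union_right (s₁ := p.support) (s₂ := q.support))]
  · exact Finset.sum_congr rfl fun α _ => by ring
  · intro α _ h
    simp [notMem_support_iff.mp h]
  · intro α _ h
    simp [notMem_support_iff.mp h]

theorem constantCoeff_diffOp_of_totalDegree_lt [Fintype σ] {p q : MvPolynomial σ R} {d : ℕ}
    (hp : p.IsHomogeneous d) (hq : q.totalDegree < d) :
    constantCoeff (diffOp σ R p q) = 0 := by
  rw [constantCoeff_diffOp]
  refine Finset.sum_eq_zero fun α hα => ?_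
  rw [coeff_eq_zero_of_totalDegree_lt (f := q), mul_zero, mul_zero]
  rwa [← hp.degree_eq_sum_deg_support hα]

/-- The linear substitution `X i ↦ ∑ j, S i j X j`. -/
def linSubst [Fintype σ] (S : Matrix σ σ R) : MvPolynomial σ R →ₐ[R] MvPolynomial σ R :=
  aeval fun i => ∑ j, S i j • X j

@[simp]
theorem linSubst_X [Fintype σ] (S : Matrix σ σ R) (i : σ) :
    linSubst S (X i) = ∑ j, S i j • X j := by
  simp [linSubst]

theorem pderiv_linSubst [Fintype σ] (S : Matrix σ σ R) (i : σ) (p : MvPolynomial σ R) :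
    pderiv i (linSubst S p) = ∑ j, S j i • linSubst S (pderiv j p) := by
  classical
  induction p using MvPolynomial.induction_on with
  | C a => simp [← algebraMap_eq]
  | add p q hp hq => simp [hp, hq, Finset.sum_add_distrib]
  | mul_X p j hp =>
    simp only [map_mul, Derivation.leibniz, map_add, smul_eq_mul, hp, smul_add,
      Finset.sum_add_distrib, linSubst_X, map_sum, pderiv_X, Finset.mul_sum]
    congr 1
    · simp [Pi.single_apply, Finset.sum_ite_eq]
    · simp_rw [Finset.sum_mul, Finset.smul_sum, mul_smul_comm]
      rw [Finset.sum_comm]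

/-- Iterated chain rule. On constant terms it says that the substitutions by `S` and `Sᵀ` are
adjoint for the pairing. -/
theorem diffOp_linSubst [Fintype σ] (S : Matrix σ σ R) (q p : MvPolynomial σ R) :
    diffOp σ R q (linSubst S p) = linSubst S (diffOp σ R (linSubst S.transpose q) p) := by
  induction q using MvPolynomial.induction_on generalizing p with
  | C a => simp [← algebraMap_eq]
  | add q r hq hr => simp [hq, hr]
  | mul_X q i hq =>
    simp only [map_mul, Module.End.mul_apply, diffOp_X]
    erw [pderiv_linSubst]
    simp [hq]

theorem constantCoeff_linSubst [Fintype σ] (S : Matrix σ σ R) (p : MvPolynomial σ R) :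
    constantCoeff (linSubst S p) = constantCoeff p := by
  induction p using MvPolynomial.induction_on with
  | C a => simp [← algebraMap_eq]
  | add p q hp hq => simp [hp, hq]
  | mul_X p j hp => simp [smul_eq_C_mul]

end MvPolynomial

/-! ### The Cayley operator: equivariance, non-vanishing, Cayley's identity -/

namespace CayleyIntegral

open MvPolynomial
open scoped Kronecker

variable {k : Type u} [Field k] {n : ℕ}

theorem cayleyOp_eq_diffOp : cayleyOp k n = diffOp (Fin n × Fin n) k (detX k n) := by
  rw [detX, Matrix.det_apply, map_sum]
  refine Finset.sum_congr rfl fun σ _ => ?_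
  rw [Units.smul_def, map_zsmul, ← List.prod_ofFn, map_list_prod, List.map_ofFn]
  congr 3
  funext i
  simp

theorem cayleyOp_pow_eq_diffOp (i : ℕ) :
    cayleyOp k n ^ i = diffOp (Fin n × Fin n) k (detX k n ^ i) := by
  rw [map_pow, cayleyOp_eq_diffOp]

theorem cayleyAtZero_eq (i : ℕ) (p : MatCoord k n) :
    cayleyAtZero k n i p = constantCoeff (diffOp _ k (detX k n ^ i) p) := by
  rw [cayleyAtZero, cayleyOp_pow_eq_diffOp, LinearMap.comp_apply, AlgHom.toLinearMap_apply,
    aeval_zero', Algebra.algebraMap_self, RingHom.id_apply]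

theorem isHomogeneous_detX_pow (i : ℕ) : (detX k n ^ i).IsHomogeneous (n * i) := by
  refine IsHomogeneous.pow ?_ i
  rw [detX, Matrix.det_apply]
  refine IsHomogeneous.sum _ _ _ fun σ _ => ?_
  have h := IsHomogeneous.prod Finset.univ
    (fun i : Fin n => (X (σ i, i) : MatCoord k n)) (fun _ => 1) fun i _ => isHomogeneous_X k _
  rw [Units.smul_def, zsmul_eq_mul, ← map_intCast (C (σ := Fin n × Fin n) (R := k))]
  simpa using (isHomogeneous_C (Fin n × Fin n) (((Equiv.Perm.sign σ : ℤˣ) : ℤ) : k)).mul h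

theorem cayleyAtZero_of_totalDegree_lt {i : ℕ} {p : MatCoord k n} (hn : 1 ≤ n)
    (h : p.totalDegree < i) : cayleyAtZero k n i p = 0 := by
  rw [cayleyAtZero_eq]
  exact constantCoeff_diffOp_of_totalDegree_lt (isHomogeneous_detX_pow i)
    (h.trans_le (Nat.le_mul_of_pos_left i hn))

theorem detX_ne_zero : detX k n ≠ 0 := Matrix.det_mvPolynomialX_ne_zero (Fin n) k

theorem detX_pow_eq_map (i : ℕ) :
    detX k n ^ i = map (Int.castRingHom k) ((Matrix.mvPolynomialX (Fin n) (Fin n) ℤ).det ^ i) := by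
  rw [map_pow, detX, RingHom.map_det]
  congr 2
  ext1 a b
  simp

/-- The value is `∑ α! c_α²` over the coefficients `c_α` of `det^i`. These are integers, so the sum
is a positive integer; in `k` itself squares could cancel. -/
theorem cayleyAtZero_detX_pow_ne_zero [CharZero k] (i : ℕ) :
    cayleyAtZero k n i (detX k n ^ i) ≠ 0 := by
  set q : MvPolynomial (Fin n × Fin n) ℤ := (Matrix.mvPolynomialX (Fin n) (Fin n) ℤ).det ^ i with hq
  have hq0 : q ≠ 0 := pow_ne_zero _ (Matrix.det_mvPolynomialX_ne_zero (Fin n) ℤ)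
  have hinj : Function.Injective (Int.castRingHom k) := Int.cast_injective
  have h : 0 < ∑ α ∈ q.support, (∏ j, ((α j).factorial : ℤ)) * (coeff α q * coeff α q) := by
    refine Finset.sum_pos (fun α hα => mul_pos (Finset.prod_pos fun j _ => ?_) ?_)
      (support_nonempty.mpr hq0)
    · exact_mod_cast Nat.factorial_pos _
    · exact mul_self_pos.mpr (mem_support_iff.mp hα)
  rw [cayleyAtZero_eq, constantCoeff_diffOp, detX_pow_eq_map, ← hq, support_map_of_injective _ hinj]
  have h' := hinj.ne h.ne'
  simpa [coeff_map] using h'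

/-- `g ⊗ₖ 1` is the substitution `x ↦ gx`; below, `1 ⊗ₖ g` is `x ↦ xgᵀ`. -/
theorem linSubst_kronecker_one_detX (g : Matrix (Fin n) (Fin n) k) :
    linSubst (g ⊗ₖ 1) (detX k n) = g.det • detX k n := by
  rw [detX, AlgHom.map_det, ← C_mul', RingHom.map_det, ← Matrix.det_mul]
  congr 1
  ext1 a b
  simp [Matrix.mul_apply, Fintype.sum_prod_type, Matrix.one_apply, C_mul', ite_smul]

theorem linSubst_one_kronecker_detX (g : Matrix (Fin n) (Fin n) k) :
    linSubst (1 ⊗ₖ g) (detX k n) = g.det • detX k n := by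
  rw [detX, AlgHom.map_det, ← Matrix.det_transpose g, ← C_mul', RingHom.map_det, mul_comm,
    ← Matrix.det_mul]
  congr 1
  ext1 a b
  simp [Matrix.mul_apply, Fintype.sum_prod_type, Matrix.one_apply, ite_smul, smul_eq_C_mul,
    mul_comm]

theorem cayleyOp_pow_linSubst {S : Matrix (Fin n × Fin n) (Fin n × Fin n) k} {a : k}
    (h : linSubst S.transpose (detX k n) = a • detX k n) (i : ℕ) (p : MatCoord k n) :
    (cayleyOp k n ^ i) (linSubst S p) = a ^ i • linSubst S ((cayleyOp k n ^ i) p) := by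
  rw [cayleyOp_pow_eq_diffOp, diffOp_linSubst, map_pow, h, smul_pow, map_smul,
    LinearMap.smul_apply, map_smul]

theorem cayleyAtZero_linSubst {S : Matrix (Fin n × Fin n) (Fin n × Fin n) k} {a : k}
    (h : linSubst S.transpose (detX k n) = a • detX k n) (i : ℕ) (p : MatCoord k n) :
    cayleyAtZero k n i (linSubst S p) = a ^ i * cayleyAtZero k n i p := by
  rw [cayleyAtZero_eq, cayleyAtZero_eq, ← cayleyOp_pow_eq_diffOp, cayleyOp_pow_linSubst h,
    smul_eq_C_mul, map_mul, constantCoeff_C, constantCoeff_linSubst]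

theorem eval_linSubst_kronecker_one (g : Matrix (Fin n) (Fin n) k) (p : MatCoord k n) :
    eval (fun ij : Fin n × Fin n => (1 : Matrix (Fin n) (Fin n) k) ij.1 ij.2)
      (linSubst (g ⊗ₖ 1) p) = eval (fun ij => g ij.1 ij.2) p := by
  induction p using MvPolynomial.induction_on with
  | C a => simp [← algebraMap_eq]
  | add p q hp hq => simp [hp, hq]
  | mul_X p j hp =>
    rw [map_mul, map_mul, hp, map_mul]
    congr 1
    simp [smul_eval, Fintype.sum_prod_type, Matrix.one_apply]

theorem eval_detX (g : Fin n × Fin n → k) :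
    eval g (detX k n) = (Matrix.of fun i j => g (i, j)).det :=
  Matrix.eval_det_mvPolynomialX _ _ _

/-- Cayley's identity, up to the value of the constant. -/
theorem exists_cayleyOp_detX_pow [CharZero k] (i : ℕ) :
    ∃ a : k, cayleyOp k n (detX k n ^ (i + 1)) = a • detX k n ^ i := by
  set q := cayleyOp k n (detX k n ^ (i + 1)) with hq
  -- The constant is `q(1)`. Equivariance under `x ↦ gx`, evaluated at `x = 1`, gives `det(g) q(g) =
  -- det(g)^(i+1) q(1)`. Keeping the factor `det` covers singular `g`; it is cancelled as a
  -- polynomial.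
  refine ⟨eval (fun ij : Fin n × Fin n => (1 : Matrix (Fin n) (Fin n) k) ij.1 ij.2) q, ?_⟩
  refine mul_left_cancel₀ (detX_ne_zero (k := k) (n := n)) ?_
  rw [mul_smul_comm, ← pow_succ']
  refine MvPolynomial.funext fun x => ?_
  set g : Matrix (Fin n) (Fin n) k := Matrix.of fun i j => x (i, j)
  have h := cayleyOp_pow_linSubst (S := g ⊗ₖ 1) (a := g.det)
    (by rw [← Matrix.kroneckerMap_transpose, Matrix.transpose_one, linSubst_kronecker_one_detX,
      Matrix.det_transpose]) 1 (detX k n ^ (i + 1))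
  rw [pow_one, pow_one, map_pow, linSubst_kronecker_one_detX, smul_pow, map_smul, ← hq] at h
  have h' := congrArg
    (eval fun ij : Fin n × Fin n => (1 : Matrix (Fin n) (Fin n) k) ij.1 ij.2) h
  rw [smul_eval, smul_eval, eval_linSubst_kronecker_one] at h'
  rw [map_mul, smul_eval, map_pow, eval_detX, mul_comm (eval _ q), h']
  rfl

/-- Multiplication by `det` is adjoint to `D`, so both numerator and denominator acquire the
constant `a` of Cayley's identity. -/
theorem cayleyAtZero_succ_detX_mul [CharZero k] (i : ℕ) (p : MatCoord k n) :
    cayleyAtZero k n (i + 1) (detX k n * p) / cayleyAtZero k n (i + 1) (detX k n ^ (i + 1)) =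
      cayleyAtZero k n i p / cayleyAtZero k n i (detX k n ^ i) := by
  obtain ⟨a, ha⟩ := exists_cayleyOp_detX_pow (k := k) (n := n) i
  have key (p : MatCoord k n) :
      cayleyAtZero k n (i + 1) (detX k n * p) = a * cayleyAtZero k n i p := by
    rw [cayleyAtZero_eq, constantCoeff_diffOp_comm, mul_comm, map_mul, Module.End.mul_apply,
      ← cayleyOp_eq_diffOp, ha, map_smul, smul_eq_C_mul, map_mul, constantCoeff_C,
      constantCoeff_diffOp_comm, cayleyAtZero_eq]
  have h0 := cayleyAtZero_detX_pow_ne_zero (k := k) (n := n) (i + 1)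
  rw [pow_succ', key] at h0 ⊢
  rw [key]
  exact mul_div_mul_left _ _ (left_ne_zero_of_mul h0)

end CayleyIntegral

/-! ### The series as a linear form, and its descent to `SL_n` -/

namespace CayleyIntegral

open MvPolynomial
open scoped Kronecker

variable {k : Type u} [Field k] {n : ℕ}

theorem finite_cayleyAtZero_ne_zero (hn : 1 ≤ n) (p : MatCoord k n) :
    {i : ℕ | cayleyAtZero k n i p ≠ 0}.Finite :=
  (Set.finite_Iic p.totalDegree).subset fun _ hi =>
    not_lt.mp fun h => hi (cayleyAtZero_of_totalDegree_lt hn h)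

variable (k n) in
/-- The value of the `i`-th normalized summand `D_0^i / D_0^i(det^i)`. -/
def cayleyTerm (i : ℕ) : Module.Dual k (MatCoord k n) :=
  (cayleyAtZero k n i (detX k n ^ i))⁻¹ • cayleyAtZero k n i

theorem cayleyTerm_apply (i : ℕ) (p : MatCoord k n) :
    cayleyTerm k n i p = cayleyAtZero k n i p / cayleyAtZero k n i (detX k n ^ i) := by
  rw [cayleyTerm, LinearMap.smul_apply, smul_eq_mul, div_eq_inv_mul]

theorem cayleyTerm_of_totalDegree_lt {i : ℕ} {p : MatCoord k n} (hn : 1 ≤ n)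
    (h : p.totalDegree < i) : cayleyTerm k n i p = 0 := by
  rw [cayleyTerm_apply, cayleyAtZero_of_totalDegree_lt hn h, zero_div]

theorem finite_support_cayleyTerm (hn : 1 ≤ n) (p : MatCoord k n) :
    (Function.support fun i => cayleyTerm k n i p).Finite :=
  (Set.finite_Iic p.totalDegree).subset fun _ hi =>
    not_lt.mp fun h => hi (cayleyTerm_of_totalDegree_lt hn h)

/-- The linear form `∑ i, D_0^i / D_0^i(det^i)` on `k[x_{ij}]`. -/
def cayleySum (hn : 1 ≤ n) : Module.Dual k (MatCoord k n) where
  toFun p := ∑ᶠ i, cayleyTerm k n i p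
  map_add' p q := by
    simp_rw [map_add]
    exact finsum_add_distrib (finite_support_cayleyTerm hn p) (finite_support_cayleyTerm hn q)
  map_smul' c p := by
    simp_rw [map_smul]
    exact (smul_finsum c _).symm

theorem cayleySum_eq_sum_range (hn : 1 ≤ n) {p : MatCoord k n} {d : ℕ}
    (h : ∀ i, d ≤ i → cayleyTerm k n i p = 0) :
    cayleySum hn p = ∑ i ∈ Finset.range d, cayleyTerm k n i p :=
  finsum_eq_sum_of_support_subset _ fun i hi =>
    Finset.mem_coe.mpr (Finset.mem_range.mpr (not_le.mp fun hdi => hi (h i hdi)))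

/-- The range does not depend on `S`, so for `a = det g` the right side is a fixed polynomial in
`det g`. -/
theorem cayleySum_linSubst {S : Matrix (Fin n × Fin n) (Fin n × Fin n) k} {a : k} (hn : 1 ≤ n)
    (h : linSubst S.transpose (detX k n) = a • detX k n) (p : MatCoord k n) :
    cayleySum hn (linSubst S p) =
      ∑ i ∈ Finset.range (p.totalDegree + 1), a ^ i * cayleyTerm k n i p := by
  have h' (i : ℕ) : cayleyTerm k n i (linSubst S p) = a ^ i * cayleyTerm k n i p := by
    rw [cayleyTerm_apply, cayleyTerm_apply, cayleyAtZero_linSubst h, mul_div_assoc]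
  rw [cayleySum_eq_sum_range hn (d := p.totalDegree + 1)]
  · exact Finset.sum_congr rfl fun i _ => h' i
  · intro i hi
    rw [h', cayleyTerm_of_totalDegree_lt hn hi, mul_zero]

theorem cayleyTerm_zero_apply (p : MatCoord k n) : cayleyTerm k n 0 p = constantCoeff p := by
  simp [cayleyTerm_apply, cayleyAtZero_eq]

theorem constantCoeff_detX (hn : 1 ≤ n) : constantCoeff (detX k n) = 0 := by
  rw [constantCoeff_eq]
  have h := isHomogeneous_detX_pow (k := k) (n := n) 1
  rw [pow_one, mul_one] at h
  exact h.coeff_eq_zero (by simpa using (Nat.one_le_iff_ne_zero.mp hn).symm)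

theorem cayleySum_one (hn : 1 ≤ n) : cayleySum (k := k) hn 1 = 1 := by
  rw [cayleySum_eq_sum_range hn (d := 1)
    fun i hi => cayleyTerm_of_totalDegree_lt hn (by rw [totalDegree_one]; exact hi)]
  rw [Finset.sum_range_one, cayleyTerm_zero_apply, map_one]

/-- Shift of index; the term of index 0 vanishes because `det(0) = 0` for `n ≥ 1`. -/
theorem cayleySum_detX_mul [CharZero k] (hn : 1 ≤ n) (p : MatCoord k n) :
    cayleySum hn (detX k n * p) = cayleySum hn p := by
  have h (i : ℕ) : cayleyTerm k n (i + 1) (detX k n * p) = cayleyTerm k n i p := by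
    rw [cayleyTerm_apply, cayleyTerm_apply, cayleyAtZero_succ_detX_mul]
  have hp (i : ℕ) (hi : p.totalDegree + 1 ≤ i) : cayleyTerm k n i p = 0 :=
    cayleyTerm_of_totalDegree_lt hn hi
  rw [cayleySum_eq_sum_range hn hp, cayleySum_eq_sum_range hn (d := p.totalDegree + 1 + 1),
    Finset.sum_range_succ', cayleyTerm_zero_apply, map_mul, constantCoeff_detX hn, zero_mul,
    add_zero]
  · exact Finset.sum_congr rfl fun i _ => h i
  · rintro (_ | i) hi
    · omega
    · rw [h, hp i (by omega)]

theorem slRestrict_surjective : Function.Surjective (slRestrict k n) :=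
  Ideal.Quotient.mkₐ_surjective k (slIdeal k n)

theorem slRestrict_detX : slRestrict k n (detX k n) = 1 := by
  rw [← det_slGeneric, slGeneric_eq_map, ← AlgHom.map_det]
  rfl

/-- The linear form on the ring of functions of `SL_n` induced by `∑ i, D_0^i / D_0^i(det^i)`. -/
def cayleyIntegral [CharZero k] (hn : 1 ≤ n) : Module.Dual k (SLCoord k n) :=
  Submodule.liftQ ((slIdeal k n).restrictScalars k) (cayleySum hn) (by
    intro p hp
    obtain ⟨q, rfl⟩ := Ideal.mem_span_singleton'.mp hp
    rw [LinearMap.mem_ker, mul_comm, sub_mul, one_mul, map_sub, cayleySum_detX_mul, sub_self])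

theorem cayleyIntegral_slRestrict [CharZero k] (hn : 1 ≤ n) (p : MatCoord k n) :
    cayleyIntegral hn (slRestrict k n p) = cayleySum hn p :=
  rfl

/-! ### Contraction of the comultiplication, invariance and uniqueness -/

section Contraction

variable {A : Type*} [CommRing A] [Algebra k A]

/-- The map `id ⊗ w : A ⊗ A → A`. -/
def contractRight (w : Module.Dual k A) : A ⊗[k] A →ₗ[k] A :=
  (TensorProduct.rid k A).toLinearMap ∘ₗ w.lTensor A

/-- The map `w ⊗ id : A ⊗ A → A`. -/
def contractLeft (w : Module.Dual k A) : A ⊗[k] A →ₗ[k] A :=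
  (TensorProduct.lid k A).toLinearMap ∘ₗ w.rTensor A

@[simp]
theorem contractRight_tmul (w : Module.Dual k A) (a b : A) :
    contractRight w (a ⊗ₜ b) = w b • a := by
  simp [contractRight]

@[simp]
theorem contractLeft_tmul (w : Module.Dual k A) (a b : A) :
    contractLeft w (a ⊗ₜ b) = w a • b := by
  simp [contractLeft]

theorem contractRight_map {B : Type*} [CommRing B] [Algebra k B] (f : B →ₐ[k] A)
    (w : Module.Dual k A) (t : B ⊗[k] B) :
    contractRight w (Algebra.TensorProduct.map f f t) =
      f (contractRight (w ∘ₗ f.toLinearMap) t) := by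
  induction t with
  | zero => simp
  | add s t hs ht => simp only [map_add, hs, ht]
  | tmul a b => simp

theorem contractLeft_map {B : Type*} [CommRing B] [Algebra k B] (f : B →ₐ[k] A)
    (w : Module.Dual k A) (t : B ⊗[k] B) :
    contractLeft w (Algebra.TensorProduct.map f f t) =
      f (contractLeft (w ∘ₗ f.toLinearMap) t) := by
  induction t with
  | zero => simp
  | add s t hs ht => simp only [map_add, hs, ht]
  | tmul a b => simp

end Contraction

/-- Reduces invariance against all `φ` to one identity in `A`, `(id ⊗ w)(Δ a) = w(a) · 1`. -/
theorem dualMul_apply_eq_contractRight (φ w : Module.Dual k (SLCoord k n)) (a : SLCoord k n) :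
    dualMul φ w a = φ (contractRight w (slComul k n a)) := by
  rw [dualMul, LinearMap.comp_apply, LinearMap.comp_apply, AlgHom.toLinearMap_apply]
  induction slComul k n a with
  | zero => simp
  | add s t hs ht => simp only [map_add, hs, ht]
  | tmul a b => simp [mul_comm]

theorem dualMul_apply_eq_contractLeft (φ w : Module.Dual k (SLCoord k n)) (a : SLCoord k n) :
    dualMul w φ a = φ (contractLeft w (slComul k n a)) := by
  rw [dualMul, LinearMap.comp_apply, LinearMap.comp_apply, AlgHom.toLinearMap_apply]
  induction slComul k n a with
  | zero => simp
  | add s t hs ht => simp only [map_add, hs, ht]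
  | tmul a b => simp

variable (k n) in
/-- The comultiplication `x_{ij} ↦ ∑ l, x_{il} ⊗ x_{lj}` of `k[x_{ij}]`. -/
def matComul : MatCoord k n →ₐ[k] MatCoord k n ⊗[k] MatCoord k n :=
  aeval fun ij => ∑ l, X (ij.1, l) ⊗ₜ X (l, ij.2)

theorem slComul_slRestrict (p : MatCoord k n) :
    slComul k n (slRestrict k n p) =
      Algebra.TensorProduct.map (slRestrict k n) (slRestrict k n) (matComul k n p) := by
  refine DFunLike.congr_fun (f := (slComul k n).comp (slRestrict k n))
    (g := (Algebra.TensorProduct.map (slRestrict k n) (slRestrict k n)).comp (matComul k n)) ?_ p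
  refine algHom_ext fun ij => ?_
  have h : slComul k n (slRestrict k n (X ij)) = slProduct k n ij.1 ij.2 :=
    aeval_X (fun ij : Fin n × Fin n => slProduct k n ij.1 ij.2) ij
  rw [AlgHom.comp_apply, h]
  simp [matComul, slProduct, slGeneric]

theorem eval_contractRight_matComul (w : Module.Dual k (MatCoord k n))
    (g : Fin n × Fin n → k) (p : MatCoord k n) :
    eval g (contractRight w (matComul k n p)) =
      w (linSubst ((Matrix.of fun i j => g (i, j)) ⊗ₖ 1) p) := by
  -- `F` evaluates the first factor at `g`, so `F(Δ p)` is `x ↦ p(gx)`.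
  let F : MatCoord k n ⊗[k] MatCoord k n →ₐ[k] MatCoord k n :=
    Algebra.TensorProduct.lift ((Algebra.ofId k _).comp (aeval g)) (AlgHom.id k _)
      fun _ _ => Commute.all _ _
  have hF (t : MatCoord k n ⊗[k] MatCoord k n) : eval g (contractRight w t) = w (F t) := by
    induction t with
    | zero => simp
    | add s t hs ht => simp only [map_add, hs, ht]
    | tmul a b =>
      simp only [contractRight_tmul, smul_eval, F, Algebra.TensorProduct.lift_tmul, AlgHom.id_apply,
        AlgHom.comp_apply, Algebra.ofId_apply, algebraMap_eq, C_mul', map_smul, smul_eq_mul,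
        mul_comm (w b)]
      rfl
  have hc : F.comp (matComul k n) = linSubst ((Matrix.of fun i j => g (i, j)) ⊗ₖ 1) := by
    refine algHom_ext fun ij => ?_
    simp [F, matComul, Algebra.ofId_apply, algebraMap_eq, C_mul', Fintype.sum_prod_type,
      Matrix.one_apply, ite_smul]
  rw [hF, ← hc, AlgHom.comp_apply]

theorem eval_contractLeft_matComul (w : Module.Dual k (MatCoord k n))
    (g : Fin n × Fin n → k) (p : MatCoord k n) :
    eval g (contractLeft w (matComul k n p)) =
      w (linSubst (1 ⊗ₖ (Matrix.of fun i j => g (i, j)).transpose) p) := by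
  let F : MatCoord k n ⊗[k] MatCoord k n →ₐ[k] MatCoord k n :=
    Algebra.TensorProduct.lift (AlgHom.id k _) ((Algebra.ofId k _).comp (aeval g))
      fun _ _ => Commute.all _ _
  have hF (t : MatCoord k n ⊗[k] MatCoord k n) : eval g (contractLeft w t) = w (F t) := by
    induction t with
    | zero => simp
    | add s t hs ht => simp only [map_add, hs, ht]
    | tmul a b =>
      simp only [contractLeft_tmul, smul_eval, F, Algebra.TensorProduct.lift_tmul, AlgHom.id_apply,
        AlgHom.comp_apply, Algebra.ofId_apply, algebraMap_eq, mul_comm a, C_mul', map_smul,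
        smul_eq_mul, mul_comm (w a)]
      rfl
  have hc : F.comp (matComul k n) =
      linSubst (1 ⊗ₖ (Matrix.of fun i j => g (i, j)).transpose) := by
    refine algHom_ext fun ij => ?_
    simp [F, matComul, Algebra.ofId_apply, algebraMap_eq, C_mul', Fintype.sum_prod_type,
      Matrix.one_apply, ite_smul, mul_comm (X _)]
  rw [hF, ← hc, AlgHom.comp_apply]

/-- Before restriction to `SL_n` the contraction is `∑ c_i det^i`, with `c_i` the terms of the
series at `p`; this is checked at all matrices `g` since `k` is infinite. On `SL_n`, `det = 1`. -/
theorem contractRight_cayleyIntegral [CharZero k] (hn : 1 ≤ n) (a : SLCoord k n) :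
    contractRight (cayleyIntegral hn) (slComul k n a) = cayleyIntegral hn a • 1 := by
  obtain ⟨p, rfl⟩ := slRestrict_surjective a
  have h : contractRight (cayleySum hn) (matComul k n p) =
      ∑ i ∈ Finset.range (p.totalDegree + 1), cayleyTerm k n i p • detX k n ^ i := by
    refine MvPolynomial.funext fun g => ?_
    rw [eval_contractRight_matComul, cayleySum_linSubst hn (a := (Matrix.of fun i j => g (i, j)).det),
      map_sum]
    · exact Finset.sum_congr rfl fun i _ => by rw [smul_eval, map_pow, eval_detX, mul_comm]
    · rw [← Matrix.kroneckerMap_transpose, Matrix.transpose_one, linSubst_kronecker_one_detX,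
        Matrix.det_transpose]
  have hw : cayleyIntegral hn ∘ₗ (slRestrict k n).toLinearMap = cayleySum hn := rfl
  rw [slComul_slRestrict, contractRight_map, hw, h, map_sum, cayleyIntegral_slRestrict,
    cayleySum_eq_sum_range hn fun i hi => cayleyTerm_of_totalDegree_lt hn hi, Finset.sum_smul]
  exact Finset.sum_congr rfl fun i _ => by rw [map_smul, map_pow, slRestrict_detX, one_pow]

theorem contractLeft_cayleyIntegral [CharZero k] (hn : 1 ≤ n) (a : SLCoord k n) :
    contractLeft (cayleyIntegral hn) (slComul k n a) = cayleyIntegral hn a • 1 := by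
  obtain ⟨p, rfl⟩ := slRestrict_surjective a
  have h : contractLeft (cayleySum hn) (matComul k n p) =
      ∑ i ∈ Finset.range (p.totalDegree + 1), cayleyTerm k n i p • detX k n ^ i := by
    refine MvPolynomial.funext fun g => ?_
    rw [eval_contractLeft_matComul, cayleySum_linSubst hn (a := (Matrix.of fun i j => g (i, j)).det),
      map_sum]
    · exact Finset.sum_congr rfl fun i _ => by rw [smul_eval, map_pow, eval_detX, mul_comm]
    · rw [← Matrix.kroneckerMap_transpose, Matrix.transpose_one, linSubst_one_kronecker_detX,
        Matrix.transpose_transpose]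
  have hw : cayleyIntegral hn ∘ₗ (slRestrict k n).toLinearMap = cayleySum hn := rfl
  rw [slComul_slRestrict, contractLeft_map, hw, h, map_sum, cayleyIntegral_slRestrict,
    cayleySum_eq_sum_range hn fun i hi => cayleyTerm_of_totalDegree_lt hn hi, Finset.sum_smul]
  exact Finset.sum_congr rfl fun i _ => by rw [map_smul, map_pow, slRestrict_detX, one_pow]

theorem isInvariantIntegral_cayleyIntegral [CharZero k] (hn : 1 ≤ n) :
    IsInvariantIntegral (cayleyIntegral (k := k) hn) where
  normalized := by rw [← map_one (slRestrict k n), cayleyIntegral_slRestrict, cayleySum_one]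
  left_invariant φ := LinearMap.ext fun a => by
    rw [dualMul_apply_eq_contractRight, contractRight_cayleyIntegral, map_smul,
      LinearMap.smul_apply, smul_eq_mul, smul_eq_mul, mul_comm]
  right_invariant φ := LinearMap.ext fun a => by
    rw [dualMul_apply_eq_contractLeft, contractLeft_cayleyIntegral, map_smul,
      LinearMap.smul_apply, smul_eq_mul, smul_eq_mul, mul_comm]

/-- The product `w · w'` equals `w` by invariance of `w`, and `w'` by invariance of `w'`. -/
theorem IsInvariantIntegral.eq {w w' : Module.Dual k (SLCoord k n)}
    (h : IsInvariantIntegral w) (h' : IsInvariantIntegral w') : w = w' := by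
  have h₁ := h.right_invariant w'
  have h₂ := h'.left_invariant w
  rw [h'.normalized, one_smul] at h₁
  rw [h.normalized, one_smul] at h₂
  exact h₁.symm.trans h₂

end CayleyIntegral

/-! ### Pairing with powers of linear forms -/

namespace MvPolynomial

variable {σ R : Type*} [CommRing R]

theorem constantCoeff_diffOp_of_isHomogeneous_ne [Fintype σ] {p q : MvPolynomial σ R} {d e : ℕ}
    (hp : p.IsHomogeneous d) (hq : q.IsHomogeneous e) (h : d ≠ e) :
    constantCoeff (diffOp σ R p q) = 0 := by
  rw [constantCoeff_diffOp]
  refine Finset.sum_eq_zero fun α hα => ?_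
  rw [hq.coeff_eq_zero, mul_zero, mul_zero]
  exact fun h' => h ((hp.degree_eq_sum_deg_support hα).trans h')

theorem diffOp_monomial_linear_pow [Fintype σ] (c : σ → R) (α : σ →₀ ℕ) (N : ℕ) :
    diffOp σ R (monomial α 1) ((∑ i, c i • X i) ^ (N + α.degree)) =
      ((N + 1).ascFactorial α.degree * eval c (monomial α (1 : R))) • (∑ i, c i • X i) ^ N := by
  classical
  induction α using Finsupp.induction_linear generalizing N with
  | zero => simp
  | add f g hf hg =>
    rw [← one_mul (1 : R), ← monomial_mul, map_mul, Module.End.mul_apply, map_add, ← add_assoc, hg,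
      map_smul, hf, smul_smul, map_mul, ← Nat.ascFactorial_mul_ascFactorial]
    congr 1
    push_cast
    rw [add_right_comm N 1]
    ring
  | single i b =>
    induction b generalizing N with
    | zero => simp
    | succ b hb =>
      have hX : pderiv i (∑ j, c j • (X j : MvPolynomial σ R)) = C (c i) := by
        simp [pderiv_X, Pi.single_apply, smul_eq_C_mul]
      have hpow (M : ℕ) : pderiv i ((∑ j, c j • (X j : MvPolynomial σ R)) ^ (M + 1)) =
          ((M + 1 : ℕ) * c i) • (∑ j, c j • X j) ^ M := by
        rw [pderiv_pow, hX, add_tsub_cancel_right, smul_eq_C_mul, map_mul, map_natCast]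
        ring
      rw [Finsupp.single_add, ← one_mul (1 : R), ← monomial_mul, map_mul, Module.End.mul_apply,
        map_add, ← add_assoc, Finsupp.degree_single i 1, ← X, diffOp_X, Derivation.coeFn_coe,
        hpow, map_smul, hb, map_mul, eval_X, Nat.ascFactorial_succ, smul_smul]
      congr 1
      push_cast
      ring

/-- Each `∂^α` with `|α| = d` sends the `d`-th power to `d! c^α`: pairing with it is evaluation at
`c`. -/
theorem constantCoeff_diffOp_linear_pow [Fintype σ] (c : σ → R) {p : MvPolynomial σ R} {d : ℕ}
    (hp : p.IsHomogeneous d) :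
    constantCoeff (diffOp σ R p ((∑ i, c i • X i) ^ d)) = d.factorial * eval c p := by
  conv_lhs => rw [← support_sum_monomial_coeff p]
  conv_rhs => rw [← support_sum_monomial_coeff p]
  rw [map_sum, map_sum, LinearMap.sum_apply, map_sum, Finset.mul_sum]
  refine Finset.sum_congr rfl fun α hα => ?_
  have h := diffOp_monomial_linear_pow c α 0
  rw [zero_add, zero_add, Nat.one_ascFactorial, pow_zero, Finsupp.degree_apply,
    ← hp.degree_eq_sum_deg_support hα] at h
  rw [← mul_one (coeff α p), ← smul_eq_mul, ← smul_monomial, map_smul, LinearMap.smul_apply, h]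
  simp only [smul_eq_C_mul, map_mul, constantCoeff_C, eval_C, map_one]
  ring

end MvPolynomial

/-! ### Invariant tensors and the dimension formula -/

namespace Module.Basis

variable {R M ι : Type*} [CommRing R] [AddCommGroup M] [Module R M] [Fintype ι] [DecidableEq ι]

theorem piTensorProduct_repr_map {N : ℕ} (b : Basis ι R M) (g : M →ₗ[R] M)
    (t : ⨂[R] _ : Fin N, M) (I : Fin N → ι) :
    (_root_.Basis.piTensorProduct fun _ => b).repr (PiTensorProduct.map (fun _ => g) t) I =
      ∑ J : Fin N → ι, (∏ s, LinearMap.toMatrix b b g (I s) (J s)) *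
        (_root_.Basis.piTensorProduct fun _ => b).repr t J := by
  conv_lhs => rw [← (_root_.Basis.piTensorProduct fun _ : Fin N => b).sum_repr t]
  simp only [map_sum, map_smul, _root_.Basis.piTensorProduct_apply, PiTensorProduct.map_tprod,
    Finsupp.coe_finsetSum, Finset.sum_apply, Finsupp.coe_smul, Pi.smul_apply,
    _root_.Basis.piTensorProduct_repr_tprod_apply, smul_eq_mul, LinearMap.toMatrix_apply]
  exact Finset.sum_congr rfl fun J _ => mul_comm _ _

end Module.Basis

namespace CayleyIntegral

open MvPolynomial Module
open scoped Kronecker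

variable {k : Type u} [Field k] {n : ℕ}

/-- The trace is the linear form whose coefficient vector is the identity matrix, and `det(1) = 1`.
-/
theorem cayleyAtZero_trace_pow (i N : ℕ) :
    cayleyAtZero k n i ((∑ a, X (a, a)) ^ N) = if n * i = N then (N.factorial : k) else 0 := by
  have htr : ∑ a : Fin n, (X (a, a) : MatCoord k n) =
      ∑ ab : Fin n × Fin n, (1 : Matrix (Fin n) (Fin n) k) ab.1 ab.2 • X ab := by
    simp [Fintype.sum_prod_type, Matrix.one_apply, ite_smul]
  rw [cayleyAtZero_eq]
  split_ifs with h
  · subst h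
    rw [htr, constantCoeff_diffOp_linear_pow _ (isHomogeneous_detX_pow i), map_pow, eval_detX]
    have h1 : (Matrix.of fun i j : Fin n => (1 : Matrix (Fin n) (Fin n) k) i j) = 1 := rfl
    rw [h1, Matrix.det_one, one_pow, mul_one]
  · refine constantCoeff_diffOp_of_isHomogeneous_ne (isHomogeneous_detX_pow i) (e := N) ?_ h
    simpa using (IsHomogeneous.sum Finset.univ (fun a : Fin n => (X (a, a) : MatCoord k n)) 1
      fun a _ => isHomogeneous_X k _).pow N

theorem cayleySum_trace_pow (hn : 1 ≤ n) (m : ℕ) :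
    cayleySum (k := k) hn ((∑ a, X (a, a)) ^ (n * m)) =
      ((n * m).factorial : k) / cayleyAtZero k n m (detX k n ^ m) := by
  have h : cayleySum (k := k) hn ((∑ a, X (a, a)) ^ (n * m)) =
      cayleyTerm k n m ((∑ a, X (a, a)) ^ (n * m)) := by
    refine finsum_eq_single _ m fun i hi => ?_
    rw [cayleyTerm_apply, cayleyAtZero_trace_pow, if_neg, zero_div]
    exact fun h => hi (Nat.eq_of_mul_eq_mul_left hn h)
  rw [h, cayleyTerm_apply, cayleyAtZero_trace_pow, if_pos rfl]

theorem repr_tensorPowerBaseChange {E : Type v} [AddCommGroup E] [Module k E]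
    (b : Basis (Fin n) k E) {N : ℕ} (B : Type u) [CommRing B] [Algebra k B]
    (t : ⨂[k] _ : Fin N, E) (I : Fin N → Fin n) :
    (_root_.Basis.piTensorProduct fun _ => b.baseChange B).repr
        (tensorPowerBaseChange k E N B t) I =
      algebraMap k B ((_root_.Basis.piTensorProduct fun _ => b).repr t I) := by
  induction t using PiTensorProduct.induction_on with
  | smul_tprod c x =>
    rw [map_smul, ← algebraMap_smul B c (tensorPowerBaseChange k E N B _), map_smul,
      map_smul]
    simp [tensorPowerBaseChange, ← map_prod, Algebra.smul_def]
  | add s t hs ht => simp only [map_add, Finsupp.coe_add, Pi.add_apply, hs, ht]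

variable (k) in
/-- The matrix coefficients `∏ s, x_{I s, J s}` of the tensor powers of the standard
representation. -/
def tensorCoeff {N : ℕ} (I J : Fin N → Fin n) : SLCoord k n :=
  ∏ s, slGeneric k n (I s) (J s)

/-- The point of `SL_n` with a given matrix of determinant one. -/
theorem exists_algHom_slGeneric {B : Type*} [CommRing B] [Algebra k B]
    {G : Matrix (Fin n) (Fin n) B} (hG : G.det = 1) :
    ∃ f : SLCoord k n →ₐ[k] B, ∀ i j, f (slGeneric k n i j) = G i j := by
  refine ⟨Ideal.Quotient.liftₐ (slIdeal k n)
    (aeval fun ij : Fin n × Fin n => G ij.1 ij.2) ?_, fun i j => ?_⟩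
  · intro a ha
    obtain ⟨q, rfl⟩ := Ideal.mem_span_singleton'.mp ha
    have h : aeval (fun ij : Fin n × Fin n => G ij.1 ij.2) (detX k n) = 1 := by
      rw [detX, AlgHom.map_det, ← hG]
      congr 1
      ext1 i j
      simp
    rw [map_mul, map_sub, h, map_one, sub_self, mul_zero]
  · exact aeval_X (fun ij : Fin n × Fin n => G ij.1 ij.2) (i, j)

/-- Invariance need only be tested at the generic matrix over `A`, since every point over `B` is its
image under some `A → B`. -/
theorem mem_tensorPowerInvariants_iff {E : Type v} [AddCommGroup E] [Module k E]
    (b : Basis (Fin n) k E) {N : ℕ} (t : ⨂[k] _ : Fin N, E) :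
    t ∈ tensorPowerInvariants k E N ↔ ∀ I : Fin N → Fin n,
      ∑ J, (_root_.Basis.piTensorProduct fun _ => b).repr t J • tensorCoeff k I J =
        (_root_.Basis.piTensorProduct fun _ => b).repr t I • 1 := by
  constructor
  · intro h I
    set bA := b.baseChange (SLCoord k n)
    have h' := h (SLCoord k n) (Matrix.toLin bA bA (slGeneric k n))
      (by rw [LinearMap.det_toLin, det_slGeneric])
    have h'' := congrArg (fun T => (_root_.Basis.piTensorProduct fun _ => bA).repr T I) h'
    simp only [bA.piTensorProduct_repr_map, LinearMap.toMatrix_toLin, bA,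
      repr_tensorPowerBaseChange] at h''
    rw [← Algebra.algebraMap_eq_smul_one, ← h'']
    exact Finset.sum_congr rfl fun J _ => by rw [Algebra.smul_def, mul_comm, tensorCoeff]
  · intro h B _ _ g hg
    set bB := b.baseChange B
    obtain ⟨f, hf⟩ := exists_algHom_slGeneric (k := k) (G := LinearMap.toMatrix bB bB g)
      (by rw [LinearMap.det_toMatrix, hg])
    refine (_root_.Basis.piTensorProduct fun _ => bB).ext_elem fun I => ?_
    have h' := congrArg f (h I)
    rw [bB.piTensorProduct_repr_map]
    simp only [bB, repr_tensorPowerBaseChange]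
    rw [map_smul, map_one, ← Algebra.algebraMap_eq_smul_one, map_sum] at h'
    rw [← h']
    refine Finset.sum_congr rfl fun J _ => ?_
    rw [map_smul, Algebra.smul_def, mul_comm, tensorCoeff, map_prod]
    simp only [hf, bB]

theorem prod_tmul_prod {ι A B : Type*} [CommRing A] [CommRing B] [Algebra k A] [Algebra k B]
    (s : Finset ι) (a : ι → A) (b : ι → B) :
    ∏ i ∈ s, a i ⊗ₜ[k] b i = (∏ i ∈ s, a i) ⊗ₜ[k] ∏ i ∈ s, b i := by
  classical
  induction s using Finset.induction_on with
  | empty => rfl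
  | insert i s hi h => simp [hi, h]

theorem slComul_tensorCoeff {N : ℕ} (I J : Fin N → Fin n) :
    slComul k n (tensorCoeff k I J) =
      ∑ K : Fin N → Fin n, tensorCoeff k I K ⊗ₜ[k] tensorCoeff k K J := by
  have h (i j : Fin n) : slComul k n (slGeneric k n i j) = slProduct k n i j :=
    aeval_X (fun ij : Fin n × Fin n => slProduct k n ij.1 ij.2) (i, j)
  simp only [tensorCoeff, map_prod, h, slProduct, Matrix.of_apply]
  rw [Finset.prod_univ_sum, Fintype.piFinset_univ]
  exact Finset.sum_congr rfl fun K _ => prod_tmul_prod _ _ _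

/-- The action of a linear form `w` on the tensor power, in the basis given by a basis of `E`. -/
def tensorAction {E : Type v} [AddCommGroup E] [Module k E] (b : Basis (Fin n) k E) (N : ℕ)
    (w : Module.Dual k (SLCoord k n)) : Module.End k (⨂[k] _ : Fin N, E) :=
  Matrix.toLin (_root_.Basis.piTensorProduct fun _ => b) (_root_.Basis.piTensorProduct fun _ => b)
    (Matrix.of fun I J : Fin N → Fin n => w (tensorCoeff k I J))

theorem repr_tensorAction {E : Type v} [AddCommGroup E] [Module k E] (b : Basis (Fin n) k E)
    {N : ℕ} (w : Module.Dual k (SLCoord k n)) (t : ⨂[k] _ : Fin N, E) (I : Fin N → Fin n) :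
    (_root_.Basis.piTensorProduct fun _ => b).repr (tensorAction b N w t) I =
      ∑ J, w (tensorCoeff k I J) * (_root_.Basis.piTensorProduct fun _ => b).repr t J := by
  rw [tensorAction, Matrix.repr_toLin]
  rfl

/-- Invariance of the integral puts the image among the invariants; `w 1 = 1` makes it fix them. -/
theorem isProj_tensorAction [CharZero k] (hn : 1 ≤ n) {E : Type v} [AddCommGroup E] [Module k E]
    (b : Basis (Fin n) k E) (N : ℕ) :
    LinearMap.IsProj (tensorPowerInvariants k E N) (tensorAction b N (cayleyIntegral hn)) where
  map_mem t := by
    rw [mem_tensorPowerInvariants_iff b]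
    intro I
    have h (J : Fin N → Fin n) := contractRight_cayleyIntegral hn (tensorCoeff k I J)
    simp only [slComul_tensorCoeff, map_sum, contractRight_tmul] at h
    simp only [repr_tensorAction, Finset.sum_smul, mul_smul, smul_comm (cayleyIntegral hn _)]
    rw [Finset.sum_comm]
    simp only [← Finset.smul_sum, h]
  map_id t ht := by
    refine (_root_.Basis.piTensorProduct fun _ => b).ext_elem fun I => ?_
    have h := congrArg (cayleyIntegral hn) ((mem_tensorPowerInvariants_iff b t).mp ht I)
    rw [map_smul, (isInvariantIntegral_cayleyIntegral hn).normalized, smul_eq_mul, mul_one,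
      map_sum] at h
    rw [repr_tensorAction, ← h]
    exact Finset.sum_congr rfl fun J _ => by rw [map_smul, smul_eq_mul, mul_comm]

/-- The diagonal coefficients `∏ s, x_{I s, I s}` sum over `I` to the expansion of `tr^N`. -/
theorem trace_tensorAction {E : Type v} [AddCommGroup E] [Module k E] (b : Basis (Fin n) k E)
    (N : ℕ) (w : Module.Dual k (SLCoord k n)) :
    LinearMap.trace k _ (tensorAction b N w) = w (slRestrict k n ((∑ a, X (a, a)) ^ N)) := by
  rw [tensorAction, Matrix.trace_toLin_eq, Matrix.trace, map_pow, map_sum, Fintype.sum_pow, map_sum]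
  rfl

theorem finrank_tensorPowerInvariants [CharZero k] (hn : 1 ≤ n) (E : Type v) [AddCommGroup E]
    [Module k E] (hE : finrank k E = n) (m : ℕ) :
    (finrank k (tensorPowerInvariants k E (n * m)) : k) =
      ((n * m).factorial : k) / cayleyAtZero k n m (detX k n ^ m) := by
  have : Module.Finite k E := Module.finite_of_finrank_pos (hE ▸ hn)
  have b : Basis (Fin n) k E := finBasisOfFinrankEq k E hE
  have : Module.Finite k (⨂[k] _ : Fin (n * m), E) :=
    Module.Finite.of_basis (_root_.Basis.piTensorProduct fun _ => b)
  rw [← (isProj_tensorAction hn b (n * m)).trace, trace_tensorAction, cayleyIntegral_slRestrict,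
    cayleySum_trace_pow]

end CayleyIntegral

end

theorem mainTheorem4 (k : Type u) [Field k] [CharZero k] (n : ℕ) (hn : 1 ≤ n) :
    (∃! w : Module.Dual k (CayleyIntegral.SLCoord k n),
      CayleyIntegral.IsInvariantIntegral w) ∧
    (∀ i : ℕ, CayleyIntegral.cayleyAtZero k n i (CayleyIntegral.detX k n ^ i) ≠ 0) ∧
    (∀ w : Module.Dual k (CayleyIntegral.SLCoord k n), CayleyIntegral.IsInvariantIntegral w →
      ∀ p : CayleyIntegral.MatCoord k n,
        {i : ℕ | CayleyIntegral.cayleyAtZero k n i p ≠ 0}.Finite ∧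
        CayleyIntegral.dualInclusion k n w p =
          ∑ᶠ i : ℕ, CayleyIntegral.cayleyAtZero k n i p /
            CayleyIntegral.cayleyAtZero k n i (CayleyIntegral.detX k n ^ i)) ∧
    (∀ (E : Type v) [AddCommGroup E] [Module k E], Module.finrank k E = n → ∀ m : ℕ,
      (Module.finrank k (CayleyIntegral.tensorPowerInvariants k E (n * m)) : k) =
        (Nat.factorial (n * m) : k) /
          CayleyIntegral.cayleyAtZero k n m (CayleyIntegral.detX k n ^ m)) := by
  refine ⟨⟨CayleyIntegral.cayleyIntegral hn, CayleyIntegral.isInvariantIntegral_cayleyIntegral hn,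
    fun w hw => hw.eq (CayleyIntegral.isInvariantIntegral_cayleyIntegral hn)⟩,
    CayleyIntegral.cayleyAtZero_detX_pow_ne_zero,
    fun w hw p => ⟨CayleyIntegral.finite_cayleyAtZero_ne_zero hn p, ?_⟩,
    fun E _ _ hE m => CayleyIntegral.finrank_tensorPowerInvariants hn E hE m⟩
  rw [hw.eq (CayleyIntegral.isInvariantIntegral_cayleyIntegral hn)]
  exact finsum_congr fun i => CayleyIntegral.cayleyTerm_apply i p
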